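/- **Lemma 5.4 (Eigenvalues of the Johnson graph).** For $n,m,d\in\mathbb{N}$ let $J(n,m,d)$ be the undirected graph whose vertices are the points of $\{0,1\}^{n}$ of Hamming weight exactly $m$, two points $\mathbf a,\mathbf b$ being adjacent exactly when their Hamming distance is $2d$ (so for $d=0$ each vertex carries a single loop, which counts once in its degree). A graph is an $(N,D,\lambda)$-expander if it is a $D$-regular graph on $N$ vertices and the second-largest absolute value of an eigenvalue of its adjacency matrix, the eigenvalues being counted with multiplicity, is at most $\lambda\cdot D$. For every constant $C>0$ there are constants $A>0$ and $\eta\in(0,1)$, depending only on $C$, such that for every integer $k\ge 1$ and every integer $d\ge 0$ with $$\left|d-\frac{k}{2}\right|\le C\sqrt{k\log k},$$ the graph $J(2k,k,d)$ is a $\left(\binom{2k}{k},\ \binom{k}{d}^{2},\ \frac{A}{k^{\eta}}\right)$-expander. -/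

import Mathlib

/-- An undirected graph on `V`, given by a symmetric adjacency relation. There are no multiple edges;
loops are permitted, so that the relation may be any symmetric relation. -/
structure UndirectedGraph (V : Type*) where
  Adj : V → V → Prop
  symm : ∀ u v, Adj u v → Adj v u

namespace UndirectedGraph

variable {V : Type*}

/-- The degree of `v`: the number of `w` adjacent to `v` (a loop at `v` counts once). -/
noncomputable def degree (G : UndirectedGraph V) (v : V) : ℕ :=
  Nat.card {w : V // G.Adj v w}

open Classical in
/-- The real 0/1 adjacency matrix. -/
noncomputable def adjMatrix (G : UndirectedGraph V) : Matrix V V ℝ :=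
  Matrix.of fun u v => if G.Adj u v then 1 else 0

theorem adjMatrix_isHermitian (G : UndirectedGraph V) : G.adjMatrix.IsHermitian := by
  ext u v
  have h : G.Adj v u ↔ G.Adj u v := ⟨G.symm v u, G.symm u v⟩
  by_cases huv : G.Adj u v <;> simp [adjMatrix, huv, h]

/-- The absolute values of the eigenvalues of the adjacency matrix, listed with multiplicity
in decreasing order. -/
noncomputable def absEigenvalues [Fintype V] [DecidableEq V] (G : UndirectedGraph V) : List ℝ :=
  (Finset.univ.val.map fun v : V => |G.adjMatrix_isHermitian.eigenvalues v|).sort (· ≥ ·)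

/-- The second-largest eigenvalue in absolute value, counted with multiplicity
(`0` by convention if there are fewer than two vertices). -/
noncomputable def secondAbsEigenvalue [Fintype V] [DecidableEq V] (G : UndirectedGraph V) : ℝ :=
  G.absEigenvalues.getD 1 0

/-- `G` is an `(N, D, lam)`-expander: a `D`-regular graph on `N` vertices whose second-largest
eigenvalue in absolute value is at most `lam * D`. -/
structure IsExpander [Fintype V] [DecidableEq V] (G : UndirectedGraph V)
    (N D : ℕ) (lam : ℝ) : Prop where
  card_eq : Fintype.card V = N
  regular : ∀ v, G.degree v = D
  second_le : G.secondAbsEigenvalue ≤ lam * D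

end UndirectedGraph

/-- The slice of `{0,1}ⁿ` of the points of Hamming weight exactly `m`. -/
abbrev HammingSlice (n m : ℕ) : Type :=
  {x : Fin n → Fin 2 // hammingNorm x = m}

/-- The Johnson graph `J(n, m, d)`: its vertices are the points of Hamming weight `m` in `{0,1}ⁿ`,
two of them being adjacent exactly when their Hamming distance is `2 * d`. -/
def johnsonGraph (n m d : ℕ) : UndirectedGraph (HammingSlice n m) where
  Adj a b := hammingDist a.1 b.1 = 2 * d
  symm a b h := by rw [hammingDist_comm]; exact h

/-!
The group of permutations of the `2k` points commutes with the Johnson graph `J(2k, k, d)`, so every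
eigenspace is stable under transpositions. A nonconstant eigenfunction `F` differs from its
translate under some transposition `(a b)`, and `F - F ∘ (a b)` is again an eigenfunction, with the
same eigenvalue, and changes sign under `(a b)`. Repeating this with disjoint transpositions for as
long as the result is nonzero leads to an eigenfunction that is antisymmetric under `j ≥ 1` disjoint
transpositions and symmetric in the remaining points. Such a function is a multiple of
`s ↦ ∏ ([a ∈ s] - [b ∈ s])`, and evaluating the adjacency operator at one point of its support gives
its eigenvalue, with `m = k - j`, as the `j`-fold backward difference in `d` of `(m.choose d) ^ 2`
(`johnsonEigenvalue`, `IsSliceEigenfunction.exists_eq_johnsonEigenvalue`). As two orthogonal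
eigenvectors cannot both be constant, the second-largest absolute eigenvalue is at most the largest
`|johnsonEigenvalue m j d|` with `j ≥ 1`
(`UndirectedGraph.secondAbsEigenvalue_le_of_nonconstant`).

For the size of these numbers put `M = k - j + 1`. The first difference is
`± (M.choose e) ^ 2 * |M - 2 * e| / M`, and by Pascal's rule the other `j - 1` differences at most
replace one factor `M.choose e` by `k.choose d` (`abs_johnsonEigenvalue_succ_le`). It remains to
compare `M.choose e * |M - 2 * e| / M`, where `d - j < e ≤ d`, with `k.choose d`. If `j - 1 ≤ √k`,
the factor `|M - 2 * e| / M` is `O(k ^ (-1 / 4))`, since `|2 * d - k| = O(√(k log k))`. If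
`j - 1 > √k`, then `M.choose e` is at most `(2 / 3) ^ ⌊√k⌋ * k.choose d`. The exponent `1 / 4` is
not optimal; it allows `√(k log k)` to be bounded by a multiple of `k ^ (3 / 4)`.
-/

/-! ### Differences of squared binomial coefficients -/

/-- The eigenvalue of the Johnson graph `J(2(m + j), m + j, d)` on its `j`-th eigenspace, that is
`∑ i ≤ d, (-1) ^ i * j.choose i * (m.choose (d - i)) ^ 2`. It is defined through the recursion in `j`
that says that the `j`-th eigenvalue is the `j`-th backward difference in `d` of
`(m.choose d) ^ 2`. -/
def johnsonEigenvalue (m : ℕ) : ℕ → ℕ → ℝ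
  | 0, d => (m.choose d : ℝ) ^ 2
  | j + 1, 0 => johnsonEigenvalue m j 0
  | j + 1, d + 1 => johnsonEigenvalue m j (d + 1) - johnsonEigenvalue m j d

/-- The base case is the identity `x² - y² = (x + y) (x - y)`; passing from `r` to `r + 1` is
Pascal's rule, so that the alternating signs cost nothing once one difference has been taken. -/
theorem abs_johnsonEigenvalue_succ_le (m : ℕ) {B : ℝ} (r d : ℕ)
    (h : ∀ e i, i ≤ r → e + i = d →
      ((m + 1).choose e : ℝ) * |((m : ℝ) + 1) - 2 * e| ≤ B * (m + 1)) :
    |johnsonEigenvalue m (r + 1) d| ≤ B * ((m + 1 + r).choose d : ℝ) := by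
  induction r generalizing d with
  | zero =>
    have h0 := h d 0 le_rfl rfl
    have hm : (0 : ℝ) < m + 1 := by positivity
    cases d with
    | zero =>
      simp [johnsonEigenvalue, abs_of_pos hm] at h0 ⊢
      nlinarith
    | succ d =>
      have h1 : ((m + 1 : ℕ) : ℝ) * (m.choose d) = (m + 1).choose (d + 1) * ((d + 1 : ℕ) : ℝ) := by
        exact_mod_cast Nat.add_one_mul_choose_eq m d
      have h2 : ((m + 1).choose (d + 1) : ℝ) = m.choose d + m.choose (d + 1) := by
        exact_mod_cast Nat.choose_succ_succ m d
      have h3 : ((m : ℝ) + 1) * johnsonEigenvalue m 1 (d + 1)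
          = ((m + 1).choose (d + 1) * (((m : ℝ) + 1) - 2 * (d + 1 : ℕ)))
            * (m + 1).choose (d + 1) := by
        simp only [johnsonEigenvalue]
        push_cast at h1 ⊢
        have h4 : ((m : ℝ) + 1) * (m.choose (d + 1) - m.choose d)
          = (m + 1).choose (d + 1) * (((m : ℝ) + 1) - 2 * (d + 1)) := by
          rw [h2] at h1 ⊢; linarith
        rw [← h4, h2]; ring
      have h5 := congrArg abs h3
      rw [abs_mul, abs_mul, abs_mul, abs_of_pos hm, Nat.abs_cast] at h5
      have h6 : ((m : ℝ) + 1) * |johnsonEigenvalue m 1 (d + 1)|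
          ≤ (m + 1) * (B * (m + 1).choose (d + 1)) := by
        rw [h5]
        calc _ ≤ B * (m + 1) * ((m + 1).choose (d + 1) : ℝ) := by gcongr
          _ = _ := by ring
      simpa using le_of_mul_le_mul_left h6 hm
  | succ r ih =>
    cases d with
    | zero =>
      have := ih 0 fun e i hi he => h e i (by omega) he
      simpa [johnsonEigenvalue] using this
    | succ d =>
      have h1 := ih (d + 1) fun e i hi he => h e i (by omega) he
      have h2 := ih d fun e i hi he => h e (i + 1) (by omega) (by omega)
      have h3 : ((m + 1 + (r + 1)).choose (d + 1) : ℝ)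
          = (m + 1 + r).choose d + (m + 1 + r).choose (d + 1) := by
        exact_mod_cast Nat.choose_succ_succ (m + 1 + r) d
      rw [h3, johnsonEigenvalue]
      refine (abs_sub _ _).trans ?_
      linarith

theorem choose_le_choose_add_add (M e : ℕ) {r i : ℕ} (hi : i ≤ r) :
    M.choose e ≤ (M + r).choose (e + i) := by
  induction r generalizing i with
  | zero => simp_all
  | succ r ih =>
    cases i with
    | zero => exact Nat.choose_le_choose e (by omega)
    | succ i =>
      refine (ih (Nat.le_of_succ_le_succ hi)).trans ?_
      rw [← add_assoc, ← add_assoc, Nat.choose_succ_succ]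
      exact Nat.le_add_right _ _

/-- The hypotheses keep the ratio of column to row in `[1/3, 2/3]` along a path in Pascal's triangle
from `(M, e)` to `(M + r, e + i)`, so that each step multiplies the entry by at least `3 / 2`. -/
theorem three_pow_mul_choose_le (M e : ℕ) {r i : ℕ} (hi : i ≤ r) (h₁ : 3 * (e + i) ≤ 2 * M)
    (h₂ : 3 * (M + r) ≤ 2 * M + 3 * (e + i)) :
    3 ^ r * M.choose e ≤ 2 ^ r * (M + r).choose (e + i) := by
  induction r generalizing i with
  | zero => simp_all
  | succ r ih =>
    by_cases hir : i ≤ r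
    · have h3 := ih hir h₁ (by omega)
      have h4 := Nat.choose_mul_succ_eq (M + r) (e + i)
      have h5 : 3 * (M + r).choose (e + i) ≤ 2 * (M + r + 1).choose (e + i) := by
        have hpos : 0 < M + r + 1 := by omega
        refine Nat.le_of_mul_le_mul_right ?_ hpos
        calc 3 * (M + r).choose (e + i) * (M + r + 1)
            = (M + r + 1).choose (e + i) * (3 * (M + r + 1 - (e + i))) := by
              rw [mul_assoc, h4]; ring
          _ ≤ (M + r + 1).choose (e + i) * (2 * (M + r + 1)) := by
              exact Nat.mul_le_mul_left _ (by omega)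
          _ = _ := by ring
      calc 3 ^ (r + 1) * M.choose e = 3 * (3 ^ r * M.choose e) := by ring
        _ ≤ 3 * (2 ^ r * (M + r).choose (e + i)) := by gcongr
        _ = 2 ^ r * (3 * (M + r).choose (e + i)) := by ring
        _ ≤ 2 ^ r * (2 * (M + r + 1).choose (e + i)) := by gcongr
        _ = _ := by rw [← add_assoc]; ring
    · obtain rfl : i = r + 1 := by omega
      have h3 := ih le_rfl (by omega) (by omega)
      have h4 := Nat.add_one_mul_choose_eq (M + r) (e + r)
      have h5 : 3 * (M + r).choose (e + r) ≤ 2 * (M + r + 1).choose (e + r + 1) := by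
        have hpos : 0 < M + r + 1 := by omega
        refine Nat.le_of_mul_le_mul_right ?_ hpos
        calc 3 * (M + r).choose (e + r) * (M + r + 1)
            = 3 * ((M + r + 1) * (M + r).choose (e + r)) := by ring
          _ = (M + r + 1).choose (e + r + 1) * (3 * (e + r + 1)) := by rw [h4]; ring
          _ ≤ (M + r + 1).choose (e + r + 1) * (2 * (M + r + 1)) := by
              exact Nat.mul_le_mul_left _ (by omega)
          _ = _ := by ring
      calc 3 ^ (r + 1) * M.choose e = 3 * (3 ^ r * M.choose e) := by ring
        _ ≤ 3 * (2 ^ r * (M + r).choose (e + r)) := by gcongr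
        _ = 2 ^ r * (3 * (M + r).choose (e + r)) := by ring
        _ ≤ 2 ^ r * (2 * (M + r + 1).choose (e + r + 1)) := by gcongr
        _ = _ := by rw [← add_assoc, ← add_assoc]; ring

theorem choose_mul_abs_sub_le (M e : ℕ) :
    (M.choose e : ℝ) * |(M : ℝ) - 2 * e| ≤ M.choose e * M := by
  by_cases h : e ≤ M
  · have h' : (e : ℝ) ≤ M := by exact_mod_cast h
    gcongr
    rw [abs_le]
    constructor <;> linarith [(Nat.cast_nonneg e : (0 : ℝ) ≤ e)]
  · simp [Nat.choose_eq_zero_of_lt (not_le.mp h)]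

/-! ### Signed sums over pairs of subsets -/

section SignedSum

variable {α : Type*} [DecidableEq α]

theorem sum_powersetCard_succ_insert {s : Finset α} {a : α} (ha : a ∉ s) (n : ℕ)
    (f : Finset α → ℝ) :
    ∑ R ∈ (insert a s).powersetCard (n + 1), f R
      = ∑ R ∈ s.powersetCard (n + 1), f R + ∑ R ∈ s.powersetCard n, f (insert a R) := by
  have hmem : ∀ R ∈ s.powersetCard n, a ∉ R := fun R hR h =>
    ha ((Finset.mem_powersetCard.mp hR).1 h)
  rw [Finset.powersetCard_succ_insert ha, Finset.sum_union, Finset.sum_image]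
  · intro R hR R' hR' h
    rw [← Finset.erase_insert (hmem R hR), ← Finset.erase_insert (hmem R' hR'), h]
  · rw [Finset.disjoint_left]
    intro R hR hR'
    obtain ⟨R', -, rfl⟩ := Finset.mem_image.mp hR'
    exact ha ((Finset.mem_powersetCard.mp hR).1 (Finset.mem_insert_self a R'))

/-- A pair `(R, S)` with `R` and `S` of equal size is reached from `(∅, ∅)` by adding one point of
`X` and one point of `Y` at a time. -/
theorem apply_eq_apply_empty_of_exchange {G : Finset α → Finset α → ℝ} {X Y : Finset α}
    (h : ∀ c ∈ X, ∀ c' ∈ Y, ∀ R ⊆ X, ∀ S ⊆ Y, c ∉ R → c' ∉ S →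
      G (insert c R) (insert c' S) = G R S)
    (R S : Finset α) (hR : R ⊆ X) (hS : S ⊆ Y) (hRS : R.card = S.card) : G R S = G ∅ ∅ := by
  induction R using Finset.induction_on generalizing S with
  | empty => rw [Finset.card_empty, eq_comm, Finset.card_eq_zero] at hRS; rw [hRS]
  | insert c R hc ih =>
    rw [Finset.card_insert_of_notMem hc] at hRS
    obtain ⟨c', hc'⟩ : S.Nonempty := Finset.card_pos.mp (by omega)
    have hS' : S.erase c' ⊆ Y := (Finset.erase_subset _ _).trans hS
    have hR' : R ⊆ X := (Finset.subset_insert _ _).trans hR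
    rw [← Finset.insert_erase hc', h c (hR (Finset.mem_insert_self _ _)) c' (hS hc') R hR' _ hS' hc
      (Finset.notMem_erase _ _)]
    exact ih _ hR' hS' (by rw [Finset.card_erase_of_mem hc']; omega)

/-- Removing one pair `a`, `p a` from the ground sets splits the sum into the terms avoiding the
pair, the terms containing both of its points, which are the former with opposite sign and `d`
lowered by one, and mixed terms, which vanish: this is the recursion of `johnsonEigenvalue`. -/
theorem sum_powersetCard_eq_johnsonEigenvalue_mul {G : Finset α → Finset α → ℝ} {X Y : Finset α}
    {m : ℕ} (hX : X.card = m) (hY : Y.card = m)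
    (hG : ∀ R S, R ⊆ X → S ⊆ Y → R.card = S.card → G R S = G ∅ ∅)
    (p : α → α) (T : Finset α) (d : ℕ) (hp : Set.InjOn p T) (hXT : Disjoint X T)
    (hYT : Disjoint Y (T.image p))
    (h : ∀ a ∈ T, ∀ R S, R ⊆ X ∪ T → S ⊆ Y ∪ T.image p → a ∉ R → p a ∉ S →
      G (insert a R) (insert (p a) S) = -G R S ∧ G (insert a R) S = 0 ∧
        G R (insert (p a) S) = 0) :
    ∑ R ∈ (X ∪ T).powersetCard d, ∑ S ∈ (Y ∪ T.image p).powersetCard d, G R S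
      = johnsonEigenvalue m T.card d * G ∅ ∅ := by
  induction T using Finset.induction_on generalizing d with
  | empty =>
    rw [Finset.image_empty, Finset.union_empty, Finset.union_empty, Finset.card_empty,
      johnsonEigenvalue]
    calc _ = ∑ R ∈ X.powersetCard d, ∑ S ∈ Y.powersetCard d, G ∅ ∅ := by
          refine Finset.sum_congr rfl fun R hR => Finset.sum_congr rfl fun S hS => ?_
          rw [Finset.mem_powersetCard] at hR hS
          exact hG R S hR.1 hS.1 (hR.2.trans hS.2.symm)
      _ = _ := by simp [hX, hY]; ring
  | insert a T ha ih =>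
    have hp' : Set.InjOn p T := hp.mono (by simp)
    rw [Finset.image_insert, Finset.disjoint_insert_right] at hYT
    rw [Finset.disjoint_insert_right] at hXT
    have hpa : p a ∉ T.image p := by
      intro hmem
      obtain ⟨b, hb, hab⟩ := Finset.mem_image.mp hmem
      have : b = a := hp (by simp [hb]) (by simp) hab
      exact ha (this ▸ hb)
    have haX : a ∉ X ∪ T := by simp [hXT.1, ha]
    have hpaY : p a ∉ Y ∪ T.image p := by
      rw [Finset.mem_union, not_or]; exact ⟨hYT.1, hpa⟩
    have hsubX : X ∪ T ⊆ X ∪ insert a T :=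
      Finset.union_subset_union_right (Finset.subset_insert _ _)
    have hsubY : Y ∪ T.image p ⊆ Y ∪ (insert a T).image p :=
      Finset.union_subset_union_right (Finset.image_subset_image (Finset.subset_insert _ _))
    have ih' := fun d => ih d hp' hXT.2 hYT.2 fun b hb R S hR hS =>
      h b (Finset.mem_insert_of_mem hb) R S (hR.trans hsubX) (hS.trans hsubY)
    have ha' := fun R S (hR : R ⊆ X ∪ T) (hS : S ⊆ Y ∪ T.image p) =>
      h a (Finset.mem_insert_self _ _) R S (hR.trans hsubX) (hS.trans hsubY)
        (fun hm => haX (hR hm)) (fun hm => hpaY (hS hm))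
    rw [Finset.image_insert, Finset.union_insert, Finset.union_insert,
      Finset.card_insert_of_notMem ha]
    cases d with
    | zero =>
      have := ih' 0
      simpa [johnsonEigenvalue] using this
    | succ d =>
      rw [johnsonEigenvalue, sub_mul, ← ih' (d + 1), ← ih' d, sum_powersetCard_succ_insert haX,
        sub_eq_add_neg, ← Finset.sum_neg_distrib]
      congr 1
      · refine Finset.sum_congr rfl fun R hR => ?_
        rw [sum_powersetCard_succ_insert hpaY, add_eq_left]
        refine Finset.sum_eq_zero fun S hS => ?_
        rw [Finset.mem_powersetCard] at hR hS
        exact (ha' R S hR.1 hS.1).2.2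
      · refine Finset.sum_congr rfl fun R hR => ?_
        rw [sum_powersetCard_succ_insert hpaY, ← Finset.sum_neg_distrib, add_eq_right.mpr]
        · refine Finset.sum_congr rfl fun S hS => ?_
          rw [Finset.mem_powersetCard] at hR hS
          exact (ha' R S hR.1 hS.1).1
        · refine Finset.sum_eq_zero fun S hS => ?_
          rw [Finset.mem_powersetCard] at hR hS
          exact (ha' R S hR.1 hS.1).2.1

end SignedSum

/-! ### Eigenfunctions on the slice -/

section Eigenfunctions

variable {α : Type*} [DecidableEq α]

/-- `F` is the extension by zero, to all subsets of the finite type `α`, of an eigenfunction with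
eigenvalue `lam` of the graph on the `k`-subsets in which `s` and `t` are adjacent when `s \ t` has
`d` elements. The zero function is allowed. Extending by zero makes `F` a function on which
permutations of `α` act without reference to cardinalities. -/
structure IsSliceEigenfunction [Fintype α] (k d : ℕ) (lam : ℝ) (F : Finset α → ℝ) : Prop where
  eq_zero : ∀ s, s.card ≠ k → F s = 0
  sum_eq : ∀ s, s.card = k →
    ∑ t ∈ (Finset.univ.powersetCard k).filter (fun t => (s \ t).card = d), F t = lam * F s

/-- The neighbours of `s` are the sets `(s \ R) ∪ S` with `R ⊆ s` and `S ⊆ sᶜ` of size `d`. -/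
theorem sum_filter_sdiff_card_eq [Fintype α] {k d : ℕ} {s : Finset α} (hs : s.card = k)
    (F : Finset α → ℝ) :
    ∑ t ∈ (Finset.univ.powersetCard k).filter (fun t => (s \ t).card = d), F t
      = ∑ R ∈ s.powersetCard d, ∑ S ∈ sᶜ.powersetCard d, F ((s \ R) ∪ S) := by
  rw [← Finset.sum_product']
  symm
  refine Finset.sum_bij' (fun x _ => (s \ x.1) ∪ x.2) (fun t _ => (s \ t, t \ s)) ?_ ?_ ?_ ?_ ?_
  · rintro ⟨R, S⟩ h
    rw [Finset.mem_product, Finset.mem_powersetCard, Finset.mem_powersetCard] at h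
    obtain ⟨⟨hR, hRc⟩, hS, hSc⟩ := h
    dsimp only at hR hRc hS hSc ⊢
    have hS' := Finset.disjoint_left.mp (Finset.subset_compl_iff_disjoint_right.mp hS)
    have h1 : s \ ((s \ R) ∪ S) = R := by
      ext x
      simp only [Finset.mem_sdiff, Finset.mem_union]
      have := @hR x
      have := @hS' x
      tauto
    rw [Finset.mem_filter, Finset.mem_powersetCard, h1]
    refine ⟨⟨Finset.subset_univ _, ?_⟩, hRc⟩
    rw [Finset.card_union_of_disjoint, Finset.card_sdiff_of_subset hR]
    · have := Finset.card_le_card hR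
      omega
    · rw [Finset.disjoint_left]
      intro x hx hx'
      exact hS' hx' (Finset.mem_sdiff.mp hx).1
  · intro t ht
    rw [Finset.mem_filter, Finset.mem_powersetCard] at ht
    rw [Finset.mem_product, Finset.mem_powersetCard, Finset.mem_powersetCard]
    refine ⟨⟨Finset.sdiff_subset, ht.2⟩, ?_, ?_⟩
    · intro x hx
      exact Finset.mem_compl.mpr (Finset.mem_sdiff.mp hx).2
    · have h1 := Finset.card_sdiff_add_card_inter s t
      have h2 := Finset.card_sdiff_add_card_inter t s
      rw [Finset.inter_comm] at h2
      dsimp only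
      omega
  · rintro ⟨R, S⟩ h
    rw [Finset.mem_product, Finset.mem_powersetCard, Finset.mem_powersetCard] at h
    obtain ⟨⟨hR, hRc⟩, hS, hSc⟩ := h
    dsimp only at hR hRc hS hSc ⊢
    have hS' := Finset.disjoint_left.mp (Finset.subset_compl_iff_disjoint_right.mp hS)
    ext x
    · simp only [Finset.mem_sdiff, Finset.mem_union]
      have := @hR x
      have := @hS' x
      tauto
    · simp only [Finset.mem_sdiff, Finset.mem_union]
      have := @hR x
      have := @hS' x
      tauto
  · intro t _
    ext x
    simp only [Finset.mem_sdiff, Finset.mem_union]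
    tauto
  · intro x _
    rfl

namespace IsSliceEigenfunction

variable [Fintype α] {k d : ℕ} {lam : ℝ} {F F' : Finset α → ℝ}

theorem sub (hF : IsSliceEigenfunction k d lam F) (hF' : IsSliceEigenfunction k d lam F') :
    IsSliceEigenfunction k d lam fun s => F s - F' s where
  eq_zero s hs := by rw [hF.eq_zero s hs, hF'.eq_zero s hs, sub_zero]
  sum_eq s hs := by rw [Finset.sum_sub_distrib, hF.sum_eq s hs, hF'.sum_eq s hs, mul_sub]

theorem comp_map (hF : IsSliceEigenfunction k d lam F) (σ : Equiv.Perm α) :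
    IsSliceEigenfunction k d lam fun s => F (s.map σ.toEmbedding) where
  eq_zero s hs := hF.eq_zero _ (by rwa [Finset.card_map])
  sum_eq s hs := by
    rw [← hF.sum_eq (s.map σ.toEmbedding) (by rwa [Finset.card_map])]
    refine Finset.sum_bij' (fun t _ => t.map σ.toEmbedding) (fun t _ => t.map σ.symm.toEmbedding)
      ?_ ?_ ?_ ?_ ?_
    · intro t ht
      rw [Finset.mem_filter, Finset.mem_powersetCard] at ht ⊢
      rw [← Finset.map_sdiff, Finset.card_map, Finset.card_map]
      exact ⟨⟨Finset.subset_univ _, ht.1.2⟩, ht.2⟩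
    · intro t ht
      rw [Finset.mem_filter, Finset.mem_powersetCard] at ht ⊢
      have h1 : (s \ t.map σ.symm.toEmbedding).map σ.toEmbedding = s.map σ.toEmbedding \ t := by
        ext x; simp [Finset.mem_map_equiv]
      rw [← h1, Finset.card_map] at ht
      exact ⟨⟨Finset.subset_univ _, by rw [Finset.card_map]; exact ht.1.2⟩, ht.2⟩
    · intro t _
      ext x; simp [Finset.mem_map_equiv]
    · intro t _
      ext x; simp [Finset.mem_map_equiv]
    · intro t _
      rfl

end IsSliceEigenfunction

end Eigenfunctions

/-! ### Antisymmetrization of eigenfunctions -/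

section Antisymmetrization

variable {α : Type*} [DecidableEq α]

theorem map_swap_eq_self {s : Finset α} {a b : α} (h : a ∈ s ↔ b ∈ s) :
    s.map (Equiv.swap a b).toEmbedding = s := by
  ext x
  rw [Finset.mem_map_equiv, Equiv.symm_swap]
  by_cases hxa : x = a
  · subst hxa; rw [Equiv.swap_apply_left]; exact h.symm
  · by_cases hxb : x = b
    · subst hxb; rw [Equiv.swap_apply_right]; exact h
    · rw [Equiv.swap_apply_of_ne_of_ne hxa hxb]

theorem map_swap_map_swap (s : Finset α) (a b : α) :
    (s.map (Equiv.swap a b).toEmbedding).map (Equiv.swap a b).toEmbedding = s := by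
  ext x; simp [Finset.mem_map_equiv]

theorem map_swap_sdiff_union {s R S : Finset α} {a b : α} (ha : a ∈ s) (hb : b ∉ s) (haR : a ∉ R)
    (haS : a ∉ S) (hbS : b ∉ S) :
    ((s \ R) ∪ S).map (Equiv.swap a b).toEmbedding = (s \ insert a R) ∪ insert b S := by
  have hab : a ≠ b := fun h => hb (h ▸ ha)
  ext x
  rw [Finset.mem_map_equiv, Equiv.symm_swap]
  by_cases hxa : x = a
  · subst hxa
    simp [hb, hbS, haS, hab]
  · by_cases hxb : x = b
    · subst hxb
      simp [ha, haR]
    · rw [Equiv.swap_apply_of_ne_of_ne hxa hxb]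
      simp [hxa, hxb]

namespace IsSliceEigenfunction

variable [Fintype α] {k d : ℕ} {lam : ℝ} {F : Finset α → ℝ}

/-- A nonzero eigenfunction that changes sign under the transpositions of an involution `p` and
that is invariant under all transpositions of fixed points of `p` is, up to a scalar, the function
`∏ ([a ∈ s] - [p a ∈ s])` over the orbits `{a, p a}`, which determines its eigenvalue. -/
theorem eq_johnsonEigenvalue_of_swap (hF : IsSliceEigenfunction k d lam F)
    (hcard : Fintype.card α = 2 * k) {s : Finset α} (hs : F s ≠ 0) {p : Equiv.Perm α}
    (hp : ∀ x, p (p x) = x)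
    (hanti : ∀ c, p c ≠ c → ∀ t : Finset α, F (t.map (Equiv.swap c (p c)).toEmbedding) = -F t)
    (hsymm : ∀ c c', p c = c → p c' = c' →
      ∀ t : Finset α, F (t.map (Equiv.swap c c').toEmbedding) = F t) :
    ∃ m, m + (s.filter fun c => p c ≠ c).card = k ∧
      lam = johnsonEigenvalue m (s.filter fun c => p c ≠ c).card d := by
  have hsk : s.card = k := by
    by_contra h
    exact hs (hF.eq_zero s h)
  have hzero : ∀ c, p c ≠ c → ∀ t : Finset α, (c ∈ t ↔ p c ∈ t) → F t = 0 := by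
    intro c hc t ht
    have h1 := hanti c hc t
    rw [map_swap_eq_self ht] at h1
    linarith
  have hsplit : ∀ c, p c ≠ c → (c ∈ s ↔ p c ∉ s) := by
    intro c hc
    by_contra h
    exact hs (hzero c hc s (by tauto))
  set T := s.filter fun c => p c ≠ c with hT
  set X := s.filter fun c => p c = c with hX
  set Y := sᶜ.filter fun c => p c = c with hY
  have hXT : X ∪ T = s := Finset.filter_union_filter_not_eq _ s
  have hTp : T.image p = sᶜ.filter fun c => ¬ p c = c := by
    ext x
    simp only [hT, Finset.mem_image, Finset.mem_filter, Finset.mem_compl]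
    constructor
    · rintro ⟨a, ⟨ha, hpa⟩, rfl⟩
      exact ⟨(hsplit a hpa).mp ha, fun h => hpa (p.injective h)⟩
    · rintro ⟨hx, hpx⟩
      refine ⟨p x, ⟨?_, fun h => hpx (p.injective h)⟩, hp x⟩
      by_contra h
      exact hx ((hsplit x hpx).mpr h)
  have hYT : Y ∪ T.image p = sᶜ := by
    rw [hTp]; exact Finset.filter_union_filter_not_eq _ sᶜ
  have hdX : Disjoint X T := Finset.disjoint_filter_filter_not _ _ _
  have hdY : Disjoint Y (T.image p) := by
    rw [hTp]; exact Finset.disjoint_filter_filter_not _ _ _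
  have hcX : X.card + T.card = k := by
    rw [← Finset.card_union_of_disjoint hdX, hXT, hsk]
  have hcY : Y.card + T.card = k := by
    have h1 := Finset.card_union_of_disjoint hdY
    rw [hYT, Finset.card_compl, hcard, hsk, Finset.card_image_of_injective _ p.injective] at h1
    omega
  refine ⟨X.card, hcX, ?_⟩
  have hXs : X ⊆ s := Finset.filter_subset _ _
  have hYs : Y ⊆ sᶜ := Finset.filter_subset _ _
  have hconst := apply_eq_apply_empty_of_exchange (G := fun R S => F ((s \ R) ∪ S)) (X := X) (Y := Y)
    (by
      intro c hc c' hc' R hR S hS hcR hcS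
      have hc'S := Finset.mem_compl.mp (hYs hc')
      rw [← map_swap_sdiff_union (hXs hc) hc'S hcR
        (fun h => Finset.mem_compl.mp (hYs (hS h)) (hXs hc)) hcS]
      exact hsymm c c' (Finset.mem_filter.mp hc).2 (Finset.mem_filter.mp hc').2 _)
  have hmain := sum_powersetCard_eq_johnsonEigenvalue_mul (m := X.card) rfl (by omega) hconst p T d
    p.injective.injOn hdX hdY (by
      intro a ha R S hR hS haR haS
      rw [hXT] at hR
      rw [hYT] at hS
      obtain ⟨has, hpa⟩ := Finset.mem_filter.mp ha
      have hpas := (hsplit a hpa).mp has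
      have haS' : a ∉ S := fun h => Finset.mem_compl.mp (hS h) has
      refine ⟨?_, ?_, ?_⟩
      · rw [← map_swap_sdiff_union has hpas haR haS' haS]
        exact hanti a hpa _
      · exact hzero a hpa _ (by simp [haS', haS, hpas])
      · exact hzero a hpa _ (by simp [has, haR]))
  rw [hXT, hYT, ← sum_filter_sdiff_card_eq hsk, hF.sum_eq s hsk] at hmain
  simpa [hs] using hmain

/-- Antisymmetrizing over further disjoint transpositions, as long as the result is nonzero, ends
with a function to which `eq_johnsonEigenvalue_of_swap` applies. -/
theorem exists_eq_johnsonEigenvalue_of_involution (hF : IsSliceEigenfunction k d lam F)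
    (hcard : Fintype.card α = 2 * k) (hne : ∃ s, F s ≠ 0) {p : Equiv.Perm α}
    (hp : ∀ x, p (p x) = x) (hp1 : ∃ c, p c ≠ c)
    (hanti : ∀ c, p c ≠ c → ∀ t : Finset α, F (t.map (Equiv.swap c (p c)).toEmbedding) = -F t) :
    ∃ m r, m + 1 + r = k ∧ lam = johnsonEigenvalue m (r + 1) d := by
  induction hN : (Finset.univ.filter fun c => p c = c).card using Nat.strong_induction_on
    generalizing p F with
  | _ N ih =>
  by_cases hsymm : ∀ c c', p c = c → p c' = c' →
      ∀ t : Finset α, F (t.map (Equiv.swap c c').toEmbedding) = F t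
  · obtain ⟨s, hs⟩ := hne
    obtain ⟨m, hm, hlam⟩ := hF.eq_johnsonEigenvalue_of_swap hcard hs hp hanti hsymm
    obtain ⟨c, hc⟩ := hp1
    have hpos : 0 < (s.filter fun c => p c ≠ c).card := by
      rw [Finset.card_pos]
      by_cases hcs : c ∈ s
      · exact ⟨c, Finset.mem_filter.mpr ⟨hcs, hc⟩⟩
      · refine ⟨p c, Finset.mem_filter.mpr ⟨?_, fun h => hc (p.injective h)⟩⟩
        by_contra hpc
        have h1 := hanti c hc s
        rw [map_swap_eq_self (by tauto)] at h1
        exact hs (by linarith)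
    obtain ⟨r, hr⟩ := Nat.exists_eq_succ_of_ne_zero hpos.ne'
    rw [hr] at hm hlam
    exact ⟨m, r, by omega, hlam⟩
  · push Not at hsymm
    obtain ⟨c, c', hc, hc', t, ht⟩ := hsymm
    have hcc : c ≠ c' := by
      rintro rfl
      exact ht (by simp)
    have hq : ∀ x, x ≠ c → x ≠ c' → (Equiv.swap c c' * p) x = p x := by
      intro x hx hx'
      rw [Equiv.Perm.mul_apply, Equiv.swap_apply_of_ne_of_ne]
      · intro h; exact hx (p.injective (h.trans hc.symm))
      · intro h; exact hx' (p.injective (h.trans hc'.symm))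
    have hqc : (Equiv.swap c c' * p) c = c' := by simp [hc]
    have hqc' : (Equiv.swap c c' * p) c' = c := by simp [hc']
    refine ih _ ?_ (hF.sub (hF.comp_map (Equiv.swap c c'))) ⟨t, ?_⟩ (p := Equiv.swap c c' * p)
      ?_ ⟨c, by rw [hqc]; exact hcc.symm⟩ ?_ rfl
    · rw [← hN]
      refine Finset.card_lt_card (Finset.ssubset_iff_of_subset ?_ |>.mpr ⟨c, ?_, ?_⟩)
      · intro x hx
        rw [Finset.mem_filter] at hx ⊢
        by_cases hxc : x = c
        · rw [hxc]; exact ⟨Finset.mem_univ _, hc⟩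
        · by_cases hxc' : x = c'
          · rw [hxc']; exact ⟨Finset.mem_univ _, hc'⟩
          · rw [hq x hxc hxc'] at hx; exact hx
      · simp [hc]
      · rw [Finset.mem_filter, hqc]
        exact fun h => hcc h.2.symm
    · exact sub_ne_zero.mpr (Ne.symm ht)
    · intro x
      by_cases hxc : x = c
      · rw [hxc, hqc, hqc']
      · by_cases hxc' : x = c'
        · rw [hxc', hqc', hqc]
        · rw [hq x hxc hxc', hq, hp]
          · intro h; exact hxc (p.injective (h.trans hc.symm))
          · intro h; exact hxc' (p.injective (h.trans hc'.symm))
    · intro x hx u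
      by_cases hxc : x = c
      · rw [hxc, hqc, map_swap_map_swap]; ring
      · by_cases hxc' : x = c'
        · rw [hxc', hqc', Equiv.swap_comm c' c, map_swap_map_swap]; ring
        · rw [hq x hxc hxc'] at hx ⊢
          have hpxc : p x ≠ c := fun h => hxc (p.injective (h.trans hc.symm))
          have hpxc' : p x ≠ c' := fun h => hxc' (p.injective (h.trans hc'.symm))
          have hcomm : (u.map (Equiv.swap x (p x)).toEmbedding).map (Equiv.swap c c').toEmbedding
              = (u.map (Equiv.swap c c').toEmbedding).map (Equiv.swap x (p x)).toEmbedding := by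
            have hc2 : Equiv.swap x (p x) * Equiv.swap c c' = Equiv.swap c c' * Equiv.swap x (p x) :=
              Equiv.Perm.Disjoint.commute
                (Equiv.Perm.disjoint_swap_swap
                  (by simp [Ne.symm hx, hxc, hxc', hpxc, hpxc', hcc]))
            ext y
            simp only [Finset.mem_map_equiv, Equiv.symm_swap]
            have := Equiv.congr_fun hc2 y
            simp only [Equiv.Perm.mul_apply] at this
            rw [this]
          rw [hcomm, hanti x hx, hanti x hx]; ring

theorem exists_eq_johnsonEigenvalue (hF : IsSliceEigenfunction k d lam F)
    (hcard : Fintype.card α = 2 * k) {s t : Finset α} (hs : s.card = k) (ht : t.card = k)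
    (hst : F s ≠ F t) :
    ∃ m r, m + 1 + r = k ∧ lam = johnsonEigenvalue m (r + 1) d := by
  obtain ⟨c, c', u, hu⟩ : ∃ c c', ∃ u : Finset α, F (u.map (Equiv.swap c c').toEmbedding) ≠ F u := by
    by_contra! h
    have hts : (s \ t).card = (t \ s).card := by
      have h1 := Finset.card_sdiff_add_card_inter s t
      have h2 := Finset.card_sdiff_add_card_inter t s
      rw [Finset.inter_comm] at h2
      omega
    have h1 := apply_eq_apply_empty_of_exchange (G := fun R S => F ((s \ R) ∪ S)) (X := s) (Y := sᶜ)
      (by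
        intro c hc c' hc' R hR S hS hcR hcS
        rw [← map_swap_sdiff_union hc (Finset.mem_compl.mp hc') hcR
          (fun h => Finset.mem_compl.mp (hS h) hc) hcS]
        exact h _ _ _) (s \ t) (t \ s) Finset.sdiff_subset
      (fun x hx => Finset.mem_compl.mpr (Finset.mem_sdiff.mp hx).2) hts
    have h2 : (s \ (s \ t)) ∪ (t \ s) = t := by
      ext x
      simp only [Finset.mem_sdiff, Finset.mem_union]
      tauto
    simp only [h2, Finset.sdiff_empty, Finset.union_empty] at h1
    exact hst h1.symm
  have hcc : c ≠ c' := by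
    rintro rfl
    exact hu (by simp)
  refine (hF.sub (hF.comp_map (Equiv.swap c c'))).exists_eq_johnsonEigenvalue_of_involution hcard
    ⟨u, sub_ne_zero.mpr hu.symm⟩ (p := Equiv.swap c c') (by simp) ⟨c, by simpa using hcc.symm⟩ ?_
  intro x hx u
  by_cases hxc : x = c
  · rw [hxc, Equiv.swap_apply_left, map_swap_map_swap]; ring
  · by_cases hxc' : x = c'
    · rw [hxc', Equiv.swap_apply_right, Equiv.swap_comm c' c, map_swap_map_swap]; ring
    · exact absurd (Equiv.swap_apply_of_ne_of_ne hxc hxc') hx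

end IsSliceEigenfunction

end Antisymmetrization

/-! ### The second-largest absolute eigenvalue -/

theorem UndirectedGraph.secondAbsEigenvalue_le {V : Type*} [Fintype V] [DecidableEq V]
    (G : UndirectedGraph V) {B : ℝ} (hB : 0 ≤ B)
    (h : ∀ u w, B < |G.adjMatrix_isHermitian.eigenvalues u| →
      B < |G.adjMatrix_isHermitian.eigenvalues w| → u = w) :
    G.secondAbsEigenvalue ≤ B := by
  have hcount : (G.absEigenvalues).countP (fun x => B < x) ≤ 1 := by
    rw [← Multiset.coe_countP (B < ·), UndirectedGraph.absEigenvalues, Multiset.sort_eq,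
      Multiset.countP_map]
    change (Finset.univ.filter fun v => B < |G.adjMatrix_isHermitian.eigenvalues v|).card ≤ 1
    rw [Finset.card_le_one]
    intro u hu w hw
    exact h u w (Finset.mem_filter.mp hu).2 (Finset.mem_filter.mp hw).2
  have hsort : G.absEigenvalues.Pairwise (· ≥ ·) := Multiset.pairwise_sort _ _
  rw [UndirectedGraph.secondAbsEigenvalue]
  rcases hl : G.absEigenvalues with _ | ⟨x, _ | ⟨y, l⟩⟩
  · simpa using hB
  · simpa using hB
  · rw [hl] at hcount hsort
    by_contra hlt
    have hy : B < y := by simpa using hlt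
    have hx : B < x := hy.trans_le (by simpa using (List.pairwise_cons.mp hsort).1 y (by simp))
    simp [hx, hy] at hcount

/-- Two orthonormal eigenvectors cannot both be constant. -/
theorem UndirectedGraph.secondAbsEigenvalue_le_of_nonconstant {V : Type*} [Fintype V]
    [DecidableEq V] (G : UndirectedGraph V) {B : ℝ} (hB : 0 ≤ B)
    (h : ∀ (lam : ℝ) (v : V → ℝ), G.adjMatrix.mulVec v = lam • v → (∃ x y, v x ≠ v y) →
      |lam| ≤ B) :
    G.secondAbsEigenvalue ≤ B := by
  refine G.secondAbsEigenvalue_le hB fun u w hu hw => ?_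
  have hconst : ∀ u, B < |G.adjMatrix_isHermitian.eigenvalues u| →
      ∀ x y, (G.adjMatrix_isHermitian.eigenvectorBasis u) x
        = (G.adjMatrix_isHermitian.eigenvectorBasis u) y := by
    intro u hu
    by_contra! hne
    exact hu.not_ge (h _ _ (G.adjMatrix_isHermitian.mulVec_eigenvectorBasis u) hne)
  by_contra huw
  have horth := G.adjMatrix_isHermitian.eigenvectorBasis.orthonormal
  have h0 : inner ℝ (G.adjMatrix_isHermitian.eigenvectorBasis u)
      (G.adjMatrix_isHermitian.eigenvectorBasis w) = 0 := horth.2 huw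
  have hnz : ∀ u, B < |G.adjMatrix_isHermitian.eigenvalues u| →
      ∀ x, (G.adjMatrix_isHermitian.eigenvectorBasis u) x ≠ 0 := by
    intro u hu x hx
    have h1 := horth.1 u
    have h2 : G.adjMatrix_isHermitian.eigenvectorBasis u = 0 := by
      ext y
      rw [hconst u hu y x, hx]; rfl
    rw [h2, norm_zero] at h1
    exact zero_ne_one h1
  rw [PiLp.inner_apply] at h0
  have h1 : ∀ x, inner ℝ ((G.adjMatrix_isHermitian.eigenvectorBasis u) x)
      ((G.adjMatrix_isHermitian.eigenvectorBasis w) x)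
        = (G.adjMatrix_isHermitian.eigenvectorBasis w) u
          * (G.adjMatrix_isHermitian.eigenvectorBasis u) u := by
    intro x
    rw [hconst u hu x u, hconst w hw x u]
    simp
  simp only [h1, Finset.sum_const, nsmul_eq_mul, mul_eq_zero, Nat.cast_eq_zero,
    Finset.card_eq_zero] at h0
  rcases h0 with h0 | h0 | h0
  · exact (Finset.ne_empty_of_mem (Finset.mem_univ u)) h0
  · exact hnz w hw u h0
  · exact hnz u hu u h0

/-! ### The Johnson graph on subsets -/

/-- The points of Hamming weight `k` in `{0,1}ⁿ` are the indicator functions of the `k`-subsets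
of `Fin n`. -/
def hammingSliceEquiv (n k : ℕ) : HammingSlice n k ≃ {s : Finset (Fin n) // s.card = k} where
  toFun x := ⟨Finset.univ.filter fun i => x.1 i ≠ 0, x.2⟩
  invFun s := ⟨fun i => if i ∈ s.1 then 1 else 0, by simpa [hammingNorm] using s.2⟩
  left_inv x := by
    ext i
    have : ∀ a : Fin 2, ((if a ≠ 0 then 1 else 0 : Fin 2) : ℕ) = a := by decide
    simpa using this (x.1 i)
  right_inv s := by
    ext i
    simp

theorem hammingDist_hammingSliceEquiv_symm {n k : ℕ} (s t : {s : Finset (Fin n) // s.card = k}) :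
    hammingDist ((hammingSliceEquiv n k).symm s).1 ((hammingSliceEquiv n k).symm t).1
      = 2 * (s.1 \ t.1).card := by
  have h1 := Finset.card_sdiff_add_card_inter s.1 t.1
  have h2 := Finset.card_sdiff_add_card_inter t.1 s.1
  rw [Finset.inter_comm] at h2
  have h3 : hammingDist ((hammingSliceEquiv n k).symm s).1 ((hammingSliceEquiv n k).symm t).1
      = ((s.1 \ t.1) ∪ (t.1 \ s.1)).card := by
    rw [hammingDist]
    congr 1
    ext i
    by_cases hs : i ∈ s.1 <;> by_cases ht : i ∈ t.1 <;> simp [hammingSliceEquiv, hs, ht]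
  rw [h3, Finset.card_union_of_disjoint disjoint_sdiff_sdiff]
  have := s.2
  have := t.2
  omega

theorem card_hammingSlice (n k : ℕ) : Fintype.card (HammingSlice n k) = n.choose k := by
  rw [Fintype.card_congr (hammingSliceEquiv n k), Fintype.card_finset_len, Fintype.card_fin]

open Classical in
theorem sum_johnsonGraph_adj {n k d : ℕ} (x : HammingSlice n k) (F : Finset (Fin n) → ℝ) :
    ∑ y, (if (johnsonGraph n k d).Adj x y then F (hammingSliceEquiv n k y).1 else 0)
      = ∑ t ∈ (Finset.univ.powersetCard k).filter
          (fun t => ((hammingSliceEquiv n k x).1 \ t).card = d), F t := by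
  rw [← Finset.sum_filter]
  refine Finset.sum_bij (fun y _ => (hammingSliceEquiv n k y).1) ?_ ?_ ?_ ?_
  · intro y hy
    have h1 : hammingDist x.1 y.1 = 2 * d := (Finset.mem_filter.mp hy).2
    have h2 := hammingDist_hammingSliceEquiv_symm (hammingSliceEquiv n k x) (hammingSliceEquiv n k y)
    rw [Equiv.symm_apply_apply, Equiv.symm_apply_apply] at h2
    rw [Finset.mem_filter, Finset.mem_powersetCard]
    exact ⟨⟨Finset.subset_univ _, (hammingSliceEquiv n k y).2⟩, by omega⟩
  · intro y _ y' _ h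
    exact (hammingSliceEquiv n k).injective (Subtype.ext h)
  · intro t ht
    rw [Finset.mem_filter, Finset.mem_powersetCard] at ht
    refine ⟨(hammingSliceEquiv n k).symm ⟨t, ht.1.2⟩, ?_, by simp⟩
    rw [Finset.mem_filter]
    refine ⟨Finset.mem_univ _, ?_⟩
    have h2 := hammingDist_hammingSliceEquiv_symm (hammingSliceEquiv n k x) ⟨t, ht.1.2⟩
    rw [Equiv.symm_apply_apply] at h2
    exact h2.trans (congrArg (2 * ·) ht.2)
  · intro y _
    rfl

theorem johnsonGraph_degree (k d : ℕ) (x : HammingSlice (2 * k) k) :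
    (johnsonGraph (2 * k) k d).degree x = k.choose d ^ 2 := by
  classical
  have h1 := sum_johnsonGraph_adj (d := d) x fun _ => (1 : ℝ)
  rw [sum_filter_sdiff_card_eq (hammingSliceEquiv (2 * k) k x).2] at h1
  have h2 : ((hammingSliceEquiv (2 * k) k x).1)ᶜ.card = k := by
    rw [Finset.card_compl, Fintype.card_fin, (hammingSliceEquiv (2 * k) k x).2]; omega
  simp only [Finset.sum_const, Finset.card_powersetCard, h2,
    (hammingSliceEquiv (2 * k) k x).2, nsmul_eq_mul, mul_one, Finset.sum_boole] at h1
  rw [UndirectedGraph.degree, Nat.card_eq_fintype_card, Fintype.card_subtype, sq]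
  exact_mod_cast h1

theorem exists_eq_johnsonEigenvalue_of_mulVec {k d : ℕ} {lam : ℝ}
    {v : HammingSlice (2 * k) k → ℝ} (hv : (johnsonGraph (2 * k) k d).adjMatrix.mulVec v = lam • v)
    (hne : ∃ x y, v x ≠ v y) :
    ∃ m r, m + 1 + r = k ∧ lam = johnsonEigenvalue m (r + 1) d := by
  classical
  set F : Finset (Fin (2 * k)) → ℝ := fun s =>
    if h : s.card = k then v ((hammingSliceEquiv (2 * k) k).symm ⟨s, h⟩) else 0 with hFdef
  have hFv : ∀ x, F (hammingSliceEquiv (2 * k) k x).1 = v x := by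
    intro x
    simp [hFdef, (hammingSliceEquiv (2 * k) k x).2]
  have hF : IsSliceEigenfunction k d lam F := by
    refine ⟨fun s hs => by simp [hFdef, hs], fun s hs => ?_⟩
    obtain ⟨x, hx⟩ := (hammingSliceEquiv (2 * k) k).surjective ⟨s, hs⟩
    have h1 := sum_johnsonGraph_adj (d := d) x F
    have h2 := congrFun hv x
    simp only [hFv] at h1
    have h3 : (hammingSliceEquiv (2 * k) k x).1 = s := by rw [hx]
    rw [h3] at h1
    rw [← h1, ← h3, hFv]
    simpa [Matrix.mulVec, dotProduct, UndirectedGraph.adjMatrix] using h2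
  obtain ⟨x, y, hxy⟩ := hne
  exact hF.exists_eq_johnsonEigenvalue (by simp) (hammingSliceEquiv (2 * k) k x).2
    (hammingSliceEquiv (2 * k) k y).2 (by rwa [hFv, hFv])

/-! ### Size of the eigenvalues -/

theorem sqrt_mul_log_pow_four_le {u : ℝ} (hu : 1 ≤ u) :
    Real.sqrt (u ^ 4 * Real.log (u ^ 4)) ≤ 3 / 2 * u ^ 3 := by
  have hu0 : 0 < u := by linarith
  rw [Real.sqrt_le_left (by positivity)]
  have h1 : Real.log (u ^ 4) = 2 * Real.log (u ^ 2) := by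
    rw [Real.log_pow, Real.log_pow]; push_cast; ring
  have h2 : Real.log (u ^ 2) ≤ u ^ 2 := by
    linarith [Real.log_le_sub_one_of_pos (show 0 < u ^ 2 by positivity)]
  calc u ^ 4 * Real.log (u ^ 4) ≤ u ^ 4 * (2 * u ^ 2) := by rw [h1]; gcongr
    _ = 2 * u ^ 6 := by ring
    _ ≤ 9 / 4 * u ^ 6 := by gcongr; norm_num
    _ = (3 / 2 * u ^ 3) ^ 2 := by ring

theorem mul_pow_three_add_le_pow_four {C u : ℝ} (hu : 1 ≤ u) (h : 9 * C + 4 < u) :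
    9 * (C * u ^ 3) + 4 * u ^ 3 ≤ u ^ 4 := by
  have hu0 : 0 < u := by linarith
  calc _ = (9 * C + 4) * u ^ 3 := by ring
    _ ≤ u * u ^ 3 := by gcongr
    _ = u ^ 4 := by ring

/-- In the rows at most `√k` above row `k`, the central difference factor `|M - 2 * e| / M` is
small. -/
theorem choose_mul_abs_sub_le_of_le_sqrt {C u : ℝ} (hC : 0 < C) (hu : 1 ≤ u)
    (hCu : 9 * C + 4 < u) {d M r e i : ℕ} (huk : u ^ 4 = (M + r : ℕ))
    (hd : |(((e + i : ℕ) : ℝ)) - u ^ 4 / 2| ≤ C * (3 / 2 * u ^ 3)) (hi : i ≤ r)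
    (hed : e + i = d) (hr : (r : ℝ) ≤ u ^ 2) :
    (M.choose e : ℝ) * |(M : ℝ) - 2 * e| ≤ (9 * C + 4) / u * (M + r).choose d * M := by
  have hu0 : 0 < u := by linarith
  have hu4 := mul_pow_three_add_le_pow_four hu hCu
  have hu23 : u ^ 2 ≤ u ^ 3 := pow_le_pow_right₀ hu (by norm_num)
  have hu34 : u ^ 3 ≤ u ^ 4 := pow_le_pow_right₀ hu (by norm_num)
  have hC3 : 0 < C * u ^ 3 := by positivity
  have hC4 : 0 < C * u ^ 4 := by positivity
  have hir : (i : ℝ) ≤ r := by exact_mod_cast hi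
  have hi0 : (0 : ℝ) ≤ i := Nat.cast_nonneg i
  have hmono : (M.choose e : ℝ) ≤ (M + r).choose d := by
    rw [← hed]; exact_mod_cast choose_le_choose_add_add M e hi
  push_cast at huk hd
  obtain ⟨hd1, hd2⟩ := abs_le.mp hd
  have h1 : |(M : ℝ) - 2 * e| ≤ 3 * (C * u ^ 3) + u ^ 2 := by
    rw [abs_le]; constructor <;> linarith
  have h2 : 3 * (C * u ^ 3) + u ^ 2 ≤ (9 * C + 4) / u * M := by
    rw [div_mul_eq_mul_div, le_div_iff₀ hu0]
    have h3 : u ^ 4 / 2 ≤ M := by linarith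
    calc (3 * (C * u ^ 3) + u ^ 2) * u = 3 * (C * u ^ 4) + u ^ 3 := by ring
      _ ≤ 9 / 2 * (C * u ^ 4) + 2 * u ^ 4 := by linarith
      _ = (9 * C + 4) * (u ^ 4 / 2) := by ring
      _ ≤ _ := by gcongr
  calc _ ≤ ((M + r).choose d : ℝ) * ((9 * C + 4) / u * M) :=
        mul_le_mul hmono (h1.trans h2) (abs_nonneg _) (Nat.cast_nonneg _)
    _ = _ := by ring

/-- Further than `√k` rows above row `k`, the binomial coefficients themselves are small: each of
the first `√k` steps up from `(k, d)` in Pascal's triangle gains a factor `2 / 3`. -/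
theorem choose_le_of_sqrt_lt {C u : ℝ} (hC : 0 < C) (hu : 1 ≤ u) (hCu : 9 * C + 4 < u)
    {k d M r e i : ℕ} (huk : u ^ 4 = k) (hd : |(d : ℝ) - u ^ 4 / 2| ≤ C * (3 / 2 * u ^ 3))
    (hMr : M + r = k) (hi : i ≤ r) (hed : e + i = d) (hr : Nat.sqrt k < r) :
    (M.choose e : ℝ) ≤ (9 * C + 4) / u * k.choose d := by
  have hu0 : 0 < u := by linarith
  have hu4 := mul_pow_three_add_le_pow_four hu hCu
  have hu23 : u ^ 2 ≤ u ^ 3 := pow_le_pow_right₀ hu (by norm_num)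
  have hC3 : 0 < C * u ^ 3 := by positivity
  obtain ⟨hd1, hd2⟩ := abs_le.mp hd
  set l := Nat.sqrt k
  have hl1 : (l : ℝ) ≤ u ^ 2 := by
    have h1 : (l : ℝ) ^ 2 ≤ k := by exact_mod_cast Nat.sqrt_le' k
    rw [← huk, show u ^ 4 = (u ^ 2) ^ 2 by ring] at h1
    exact le_of_sq_le_sq h1 (by positivity)
  have hl2 : u ^ 2 ≤ l + 1 := by
    have h1 : (k : ℝ) ≤ ((l : ℝ) + 1) ^ 2 := by exact_mod_cast (Nat.lt_succ_sqrt' k).le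
    rw [← huk, show u ^ 4 = (u ^ 2) ^ 2 by ring] at h1
    exact le_of_sq_le_sq h1 (by positivity)
  obtain ⟨i₁, i₂, hi₁, hi₂, hi₁₂⟩ : ∃ i₁ i₂, i₁ ≤ l ∧ i₂ ≤ r - l ∧ i₂ + i₁ = i :=
    ⟨min i l, i - min i l, by omega, by omega, by omega⟩
  have hq1 : 3 * (d : ℝ) + 2 * l ≤ 2 * k := by rw [← huk]; linarith
  have hq2 : (k : ℝ) + 2 * l ≤ 3 * d := by rw [← huk]; linarith
  have hn1 : 3 * d + 2 * l ≤ 2 * k := by exact_mod_cast hq1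
  have hn2 : k + 2 * l ≤ 3 * d := by exact_mod_cast hq2
  have h1 := choose_le_choose_add_add M e hi₂
  have h2 := three_pow_mul_choose_le (M + (r - l)) (e + i₂) hi₁ (by omega) (by omega)
  rw [show M + (r - l) + l = k by omega, show e + i₂ + i₁ = d by omega] at h2
  have h3 : (3 : ℝ) ^ l * M.choose e ≤ 2 ^ l * k.choose d := by
    exact_mod_cast (Nat.mul_le_mul_left _ h1).trans h2
  have h4 : (2 : ℝ) ^ l * (u ^ 2 / 2) ≤ 3 ^ l := by
    have h5 := one_add_mul_le_pow (show (-2 : ℝ) ≤ 1 / 2 by norm_num) l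
    have h6 : (3 : ℝ) ^ l = 2 ^ l * (1 + 1 / 2) ^ l := by rw [← mul_pow]; norm_num
    rw [h6]
    exact mul_le_mul_of_nonneg_left (by linarith) (by positivity)
  have h6 : (u ^ 2 / 2) * (M.choose e : ℝ) ≤ k.choose d := by
    refine le_of_mul_le_mul_left (le_trans ?_ h3) (show (0 : ℝ) < 2 ^ l by positivity)
    rw [← mul_assoc]
    exact mul_le_mul_of_nonneg_right h4 (Nat.cast_nonneg _)
  have h7 : u ≤ (9 * C + 4) * (u ^ 2 / 2) := by
    have : u ≤ u ^ 2 := le_self_pow₀ hu (by norm_num)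
    have : 0 < C * u ^ 2 := by positivity
    linarith
  rw [div_mul_eq_mul_div, le_div_iff₀ hu0]
  calc (M.choose e : ℝ) * u ≤ M.choose e * ((9 * C + 4) * (u ^ 2 / 2)) :=
        mul_le_mul_of_nonneg_left h7 (Nat.cast_nonneg _)
    _ = (9 * C + 4) * (u ^ 2 / 2 * M.choose e) := by ring
    _ ≤ _ := mul_le_mul_of_nonneg_left h6 (by positivity)

theorem abs_johnsonEigenvalue_le {C : ℝ} (hC : 0 < C) {k d m r : ℕ} (hk : 0 < k)
    (hd : |(d : ℝ) - (k : ℝ) / 2| ≤ C * Real.sqrt ((k : ℝ) * Real.log (k : ℝ)))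
    (hmr : m + 1 + r = k) :
    |johnsonEigenvalue m (r + 1) d|
      ≤ (9 * C + 4) / (k : ℝ) ^ (1 / 4 : ℝ) * (k.choose d : ℝ) ^ 2 := by
  have hk1 : (1 : ℝ) ≤ k := by exact_mod_cast hk
  obtain ⟨u, hu⟩ : ∃ u : ℝ, u = (k : ℝ) ^ (1 / 4 : ℝ) := ⟨_, rfl⟩
  have hu1 : 1 ≤ u := hu ▸ Real.one_le_rpow hk1 (by norm_num)
  have hu0 : 0 < u := by linarith
  have huk : u ^ 4 = k := by
    rw [hu, ← Real.rpow_natCast, ← Real.rpow_mul (by positivity)]; norm_num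
  rw [← huk] at hd
  replace hd := hd.trans (mul_le_mul_of_nonneg_left (sqrt_mul_log_pow_four_le hu1) hC.le)
  have hstep : ∀ e i, i ≤ r → e + i = d → ((m + 1).choose e : ℝ) * |((m : ℝ) + 1) - 2 * e|
      ≤ (9 * C + 4) / u * k.choose d * (m + 1) := by
    intro e i hi he
    rw [show (m : ℝ) + 1 = ((m + 1 : ℕ) : ℝ) by push_cast; ring]
    have htriv := choose_mul_abs_sub_le (m + 1) e
    rcases le_or_gt u (9 * C + 4) with hsmall | hlarge
    · -- Here the factor `(9 * C + 4) / u` is at least `1`, and the trivial bound suffices.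
      have h1 : 1 ≤ (9 * C + 4) / u := (one_le_div hu0).mpr hsmall
      have hmono : ((m + 1).choose e : ℝ) ≤ k.choose d := by
        rw [← hmr, ← he]; exact_mod_cast choose_le_choose_add_add (m + 1) e hi
      exact htriv.trans (mul_le_mul_of_nonneg_right
        (hmono.trans (le_mul_of_one_le_left (Nat.cast_nonneg _) h1)) (Nat.cast_nonneg _))
    · rcases le_or_gt r (Nat.sqrt k) with hr | hr
      · have hr' : (r : ℝ) ≤ u ^ 2 := by
          have h1 : (r : ℝ) ^ 2 ≤ k := by exact_mod_cast Nat.le_sqrt'.mp hr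
          rw [← huk, show u ^ 4 = (u ^ 2) ^ 2 by ring] at h1
          exact le_of_sq_le_sq h1 (by positivity)
        have := choose_mul_abs_sub_le_of_le_sqrt hC hu1 hlarge (M := m + 1) (hmr ▸ huk)
          (he ▸ hd) hi he hr'
        rwa [hmr] at this
      · exact htriv.trans (mul_le_mul_of_nonneg_right
          (choose_le_of_sqrt_lt hC hu1 hlarge huk hd hmr hi he hr) (Nat.cast_nonneg _))
  have hfin := abs_johnsonEigenvalue_succ_le m r d hstep
  rw [hmr] at hfin
  rw [← hu]
  exact hfin.trans_eq (by ring)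

theorem lemma5p4 :
    ∀ C : ℝ, 0 < C → ∃ A η : ℝ, 0 < A ∧ 0 < η ∧ η < 1 ∧
      ∀ k d : ℕ, 0 < k →
        |(d : ℝ) - (k : ℝ) / 2| ≤ C * Real.sqrt ((k : ℝ) * Real.log (k : ℝ)) →
        (johnsonGraph (2 * k) k d).IsExpander
          (Nat.choose (2 * k) k) ((Nat.choose k d) ^ 2) (A / (k : ℝ) ^ η) := by
  intro C hC
  refine ⟨9 * C + 4, 1 / 4, by positivity, by norm_num, by norm_num, fun k d hk hd => ?_⟩
  refine ⟨card_hammingSlice _ _, johnsonGraph_degree k d, ?_⟩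
  refine UndirectedGraph.secondAbsEigenvalue_le_of_nonconstant _ (by positivity) ?_
  intro lam v hv hne
  obtain ⟨m, r, hmr, rfl⟩ := exists_eq_johnsonEigenvalue_of_mulVec hv hne
  push_cast
  exact abs_johnsonEigenvalue_le hC hk hd hmr
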